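/- Let $N\ge 0$ and let $S_N$ be the symmetric group on $N$ letters. Then $S_N$ is an $FSZ$-group; that is, for every integer $n\ge 1$ and every irreducible complex representation $V$ of the Drinfel'd double $D(S_N)$, the $n$-th Frobenius–Schur indicator $\nu_n(V)$ is a rational integer. Here, for a finite group $G$, $D(G)=\mathbb{C}^G\otimes\mathbb{C}G$ is the Hopf algebra over $\mathbb{C}$ with basis $e_g\otimes x$ ($g,x\in G$), product $(e_g\otimes x)(e_h\otimes y)=\delta_{g,\,xhx^{-1}}\,e_g\otimes xy$, unit $\sum_{g}e_g\otimes 1$, coproduct $\Delta(e_g\otimes x)=\sum_{hk=g}(e_h\otimes x)\otimes(e_k\otimes x)$, counit $\varepsilon(e_g\otimes x)=\delta_{g,1}$ and antipode $S(e_g\otimes x)=e_{x^{-1}g^{-1}x}\otimes x^{-1}$. Its normalized integral is $\Lambda=|G|^{-1}\sum_{x\in G}e_1\otimes x$ (the unique element with $h\Lambda=\varepsilon(h)\Lambda=\Lambda h$ for all $h\in D(G)$ and $\varepsilon(\Lambda)=1$). For a representation $V$ of $D(G)$ with character $\chi$, $\nu_n(V)=\chi(\Lambda^{[n]})$, where $h^{[n]}=h_1h_2\cdots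 h_n$ in Sweedler notation (the product of the tensor factors of the $n$-fold iterated coproduct of $h$). -/

import Mathlib

open scoped TensorProduct

universe u v

noncomputable section

/-- The underlying vector space of the Drinfel'd double `D(G) = ℂ^G ⊗ ℂG` of a finite group `G`
over `ℂ`: the complex vector space with basis `G × G`.  The pair `(g, x)` stands for the basis
vector `e_g ⊗ x`, where `e_g ∈ ℂ^G` is the indicator function of `{g}`. -/
def DrinfeldDouble (G : Type*) : Type _ := G × G →₀ ℂ

namespace DrinfeldDouble

section VectorSpace

variable {G : Type*}

instance : AddCommGroup (DrinfeldDouble G) := inferInstanceAs (AddCommGroup (G × G →₀ ℂ))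

instance : Module ℂ (DrinfeldDouble G) := inferInstanceAs (Module ℂ (G × G →₀ ℂ))

/-- The standard basis of `D(G)`. -/
def basis (G : Type*) : Module.Basis (G × G) ℂ (DrinfeldDouble G) :=
  Module.Basis.ofRepr (LinearEquiv.refl ℂ (G × G →₀ ℂ))

/-- The basis vector `e_g ⊗ x` of `D(G)`. -/
def e (g x : G) : DrinfeldDouble G := basis G (g, x)

/-- The linear map from `D(G)` with prescribed values on the basis vectors `e_g ⊗ x`. -/
def lift {M : Type*} [AddCommGroup M] [Module ℂ M] (f : G → G → M) : DrinfeldDouble G →ₗ[ℂ] M :=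
  (basis G).constr ℂ fun p => f p.1 p.2

@[simp] theorem lift_e {M : Type*} [AddCommGroup M] [Module ℂ M] (f : G → G → M) (g x : G) :
    lift f (e g x) = f g x := by
  simp [lift, e]

theorem hom_ext {M : Type*} [AddCommGroup M] [Module ℂ M] {φ ψ : DrinfeldDouble G →ₗ[ℂ] M}
    (h : ∀ g x, φ (e g x) = ψ (e g x)) : φ = ψ :=
  (basis G).ext fun p => h p.1 p.2

theorem induction_on [Nonempty G] {p : DrinfeldDouble G → Prop} (a : DrinfeldDouble G)
    (he : ∀ g x, p (e g x)) (hadd : ∀ a b, p a → p b → p (a + b))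
    (hsmul : ∀ (c : ℂ) a, p a → p (c • a)) : p a := by
  have hz : p 0 := by
    obtain ⟨g⟩ := ‹Nonempty G›
    simpa using hsmul 0 _ (he g g)
  have ha : a ∈ Submodule.span ℂ (Set.range (basis G)) := by
    rw [(basis G).span_eq]; trivial
  induction ha using Submodule.span_induction with
  | mem x hx => obtain ⟨q, rfl⟩ := hx; exact he q.1 q.2
  | zero => exact hz
  | add a b _ _ iha ihb => exact hadd a b iha ihb
  | smul c a _ iha => exact hsmul c a iha

instance [Finite G] : FiniteDimensional ℂ (DrinfeldDouble G) := (basis G).finiteDimensional_of_finite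

end VectorSpace

variable {G : Type*} [Group G] [Fintype G] [DecidableEq G]

/-- The multiplication of `D(G)` as a bilinear map:
`(e_g ⊗ x) (e_h ⊗ y) = δ_{g, x h x⁻¹} e_g ⊗ xy`. -/
def mulMap : DrinfeldDouble G →ₗ[ℂ] DrinfeldDouble G →ₗ[ℂ] DrinfeldDouble G :=
  lift fun g x => lift fun h y => if g = x * h * x⁻¹ then e g (x * y) else 0

instance : Mul (DrinfeldDouble G) := ⟨fun a b => mulMap a b⟩

instance : One (DrinfeldDouble G) := ⟨∑ g : G, e g 1⟩

theorem mul_def (a b : DrinfeldDouble G) : a * b = mulMap a b := rfl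

theorem one_def : (1 : DrinfeldDouble G) = ∑ g : G, e g 1 := rfl

theorem e_mul_e (g x h y : G) :
    e g x * e h y = if g = x * h * x⁻¹ then e g (x * y) else 0 := by
  simp [mul_def, mulMap]

theorem one_mul_aux (a : DrinfeldDouble G) : mulMap 1 a = a := by
  have : mulMap (1 : DrinfeldDouble G) = LinearMap.id :=
    hom_ext fun h y => by simp [one_def, mulMap]
  rw [this, LinearMap.id_apply]

theorem mul_one_aux (a : DrinfeldDouble G) : mulMap a 1 = a := by
  have : (mulMap (G := G)).flip 1 = LinearMap.id := hom_ext fun g x => by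
    have : ∀ h : G, (g = x * h * x⁻¹) ↔ (h = x⁻¹ * g * x) := fun h => by
      constructor
      · rintro rfl; group
      · rintro rfl; group
    simp [one_def, mulMap, this]
  exact congrArg (fun φ => φ a) this

theorem mul_assoc_aux (a b c : DrinfeldDouble G) :
    mulMap (mulMap a b) c = mulMap a (mulMap b c) := by
  induction a using induction_on with
  | hadd a a' h h' => simp only [map_add, LinearMap.add_apply, h, h']
  | hsmul r a h => simp only [map_smul, LinearMap.smul_apply, h]
  | he g x =>
    induction b using induction_on with
    | hadd b b' h h' => simp only [map_add, LinearMap.add_apply, h, h']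
    | hsmul r b h => simp only [map_smul, LinearMap.smul_apply, h]
    | he h y =>
      induction c using induction_on with
      | hadd c c' h h' => simp only [map_add, h, h']
      | hsmul r c h => simp only [map_smul, h]
      | he k z =>
        simp only [← mul_def, e_mul_e]
        by_cases h1 : g = x * h * x⁻¹ <;> by_cases h2 : h = y * k * y⁻¹
        · subst h2
          subst h1
          simp [mul_def, mulMap, mul_assoc]
        · have h3 : ¬ g = x * y * k * (x * y)⁻¹ := by
            rintro rfl
            apply h2
            have h1' := congrArg (fun t => x⁻¹ * t * x) h1
            simpa [mul_assoc] using h1'.symm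
          simp only [h1, h2, if_true, if_false]
          rw [← h1]
          simp only [mul_def, map_zero]
          rw [← mul_def, e_mul_e, if_neg h3]
        · simp only [h1, if_false]
          rw [if_pos h2]
          simp only [mul_def, map_zero, LinearMap.zero_apply]
          rw [← mul_def, e_mul_e, if_neg h1]
        · simp only [h1, h2, if_false, mul_def, map_zero, LinearMap.zero_apply]

instance : Ring (DrinfeldDouble G) :=
  { (inferInstance : AddCommGroup (DrinfeldDouble G)) with
    mul := (· * ·)
    one := 1
    left_distrib := fun a b c => map_add (mulMap a) b c
    right_distrib := fun a b c => by simp only [mul_def, map_add, LinearMap.add_apply]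
    zero_mul := fun a => by simp only [mul_def, map_zero, LinearMap.zero_apply]
    mul_zero := fun a => map_zero (mulMap a)
    mul_assoc := mul_assoc_aux
    one_mul := one_mul_aux
    mul_one := mul_one_aux }

instance : Algebra ℂ (DrinfeldDouble G) :=
  Algebra.ofModule
    (fun r a b => by simp only [mul_def, map_smul, LinearMap.smul_apply])
    (fun r a b => map_smul (mulMap a) r b)

/-- The coalgebra structure of `D(G)`: `Δ(e_g ⊗ x) = ∑_{hk = g} (e_h ⊗ x) ⊗ (e_k ⊗ x)` and
`ε(e_g ⊗ x) = δ_{g, 1}`. -/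
instance : CoalgebraStruct ℂ (DrinfeldDouble G) where
  comul := lift fun g x => ∑ h : G, e h x ⊗ₜ[ℂ] e (h⁻¹ * g) x
  counit := lift fun g _ => if g = 1 then 1 else 0

theorem comul_e (g x : G) :
    CoalgebraStruct.comul (R := ℂ) (e g x) = ∑ h : G, e h x ⊗ₜ[ℂ] e (h⁻¹ * g) x :=
  lift_e _ _ _

theorem counit_e (g x : G) :
    CoalgebraStruct.counit (R := ℂ) (e g x) = if g = 1 then 1 else 0 :=
  lift_e _ _ _

instance : Coalgebra ℂ (DrinfeldDouble G) where
  coassoc := hom_ext fun g x => by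
    simp only [LinearMap.comp_apply, comul_e, map_sum, LinearMap.rTensor_tmul,
      LinearMap.lTensor_tmul, TensorProduct.sum_tmul, TensorProduct.tmul_sum,
      LinearEquiv.coe_coe, TensorProduct.assoc_tmul]
    rw [Finset.sum_comm]
    refine Finset.sum_congr rfl fun h _ => ?_
    refine Fintype.sum_equiv (Equiv.mulLeft h⁻¹) _ _ fun k => ?_
    simp [mul_assoc]
  rTensor_counit_comp_comul := hom_ext fun g x => by
    simp only [LinearMap.comp_apply, comul_e, map_sum, LinearMap.rTensor_tmul, counit_e]
    rw [Finset.sum_eq_single 1 (fun h _ hh => by rw [if_neg hh, TensorProduct.zero_tmul])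
      (by simp)]
    simp
  lTensor_counit_comp_comul := hom_ext fun g x => by
    have : ∀ h : G, (h⁻¹ * g = 1) ↔ (h = g) := fun h => inv_mul_eq_one
    simp only [LinearMap.comp_apply, comul_e, map_sum, LinearMap.lTensor_tmul, counit_e, this]
    rw [Finset.sum_eq_single g (fun h _ hh => by rw [if_neg hh, TensorProduct.tmul_zero])
      (by simp)]
    simp

instance : Bialgebra ℂ (DrinfeldDouble G) :=
  Bialgebra.mk' ℂ (DrinfeldDouble G)
    (by simp [one_def, counit_e])
    (by
      intro a b
      induction a using induction_on with
      | hadd a a' h h' => simp only [map_add, add_mul, h, h']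
      | hsmul r a h => simp only [map_smul, smul_mul_assoc, h]
      | he g x =>
        induction b using induction_on with
        | hadd b b' h h' => simp only [map_add, mul_add, h, h']
        | hsmul r b h => simp only [map_smul, mul_smul_comm, h]
        | he h y =>
          rw [e_mul_e]
          by_cases h2 : h = 1
          · subst h2
            by_cases h1 : g = 1 <;> simp [counit_e, h1]
          · by_cases h1 : g = x * h * x⁻¹
            · simp [h1, counit_e, h2]
            · simp [h1, counit_e, h2])
    (by
      simp only [one_def, map_sum, comul_e, Algebra.TensorProduct.one_def,
        TensorProduct.sum_tmul, TensorProduct.tmul_sum]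
      rw [Finset.sum_comm]
      conv_rhs => rw [Finset.sum_comm]
      refine Finset.sum_congr rfl fun h _ => ?_
      exact Fintype.sum_equiv (Equiv.mulLeft h⁻¹) _ _ fun k => rfl)
    (by
      intro a b
      induction a using induction_on with
      | hadd a a' h h' => simp only [map_add, add_mul, h, h']
      | hsmul r a h => simp only [map_smul, smul_mul_assoc, h]
      | he g x =>
        induction b using induction_on with
        | hadd b b' h h' => simp only [map_add, mul_add, h, h']
        | hsmul r b h => simp only [map_smul, mul_smul_comm, h]
        | he h y =>
          have key : ∀ k l : G, (k = x * l * x⁻¹) ↔ (l = x⁻¹ * k * x) := fun k l => by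
            constructor
            · rintro rfl; group
            · rintro rfl; group
          rw [e_mul_e]
          simp only [comul_e, Finset.sum_mul_sum, Algebra.TensorProduct.tmul_mul_tmul, e_mul_e]
          by_cases h1 : g = x * h * x⁻¹
          · rw [if_pos h1, comul_e]
            refine Finset.sum_congr rfl fun k _ => ?_
            rw [Finset.sum_eq_single (x⁻¹ * k * x)]
            · rw [if_pos (by group), if_pos (by rw [h1]; group)]
            · intro l _ hl
              rw [if_neg (fun hh => hl ((key k l).1 hh)), TensorProduct.zero_tmul]
            · simp
          · rw [if_neg h1, map_zero]
            symm
            refine Finset.sum_eq_zero fun k _ => Finset.sum_eq_zero fun l _ => ?_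
            by_cases h2 : k = x * l * x⁻¹
            · have h3 : ¬ k⁻¹ * g = x * (l⁻¹ * h) * x⁻¹ := by
                intro h3
                apply h1
                have h4 : g = k * (k⁻¹ * g) := by group
                rw [h4, h3, h2]
                group
              rw [if_neg h3, TensorProduct.tmul_zero]
            · rw [if_neg h2, TensorProduct.zero_tmul])

/-- The antipode of `D(G)`: `S(e_g ⊗ x) = e_{x⁻¹ g⁻¹ x} ⊗ x⁻¹`. -/
instance : HopfAlgebra ℂ (DrinfeldDouble G) where
  antipode := lift fun g x => e (x⁻¹ * g⁻¹ * x) x⁻¹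
  mul_antipode_rTensor_comul := hom_ext fun g x => by
    have hc : CoalgebraStruct.comul (R := ℂ) (e g x) = ∑ h : G, e h x ⊗ₜ[ℂ] e (h⁻¹ * g) x :=
      comul_e g x
    have hd : CoalgebraStruct.counit (R := ℂ) (e g x) = if g = 1 then 1 else 0 := counit_e g x
    simp only [LinearMap.comp_apply, hc, hd, map_sum, LinearMap.rTensor_tmul, lift_e,
      LinearMap.mul'_apply, e_mul_e, Algebra.linearMap_apply]
    by_cases hg : g = 1
    · subst hg
      simp only [mul_one, inv_inv, if_true, map_one, inv_mul_cancel, one_def]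
      exact Fintype.sum_equiv ((MulAut.conj x⁻¹).toEquiv.trans (Equiv.inv G) ) _ _ fun h => by
        simp [mul_assoc]
    · simp [hg]
  mul_antipode_lTensor_comul := hom_ext fun g x => by
    have hc : CoalgebraStruct.comul (R := ℂ) (e g x) = ∑ h : G, e h x ⊗ₜ[ℂ] e (h⁻¹ * g) x :=
      comul_e g x
    have hd : CoalgebraStruct.counit (R := ℂ) (e g x) = if g = 1 then 1 else 0 := counit_e g x
    simp only [LinearMap.comp_apply, hc, hd, map_sum, LinearMap.lTensor_tmul, lift_e,
      LinearMap.mul'_apply, e_mul_e, Algebra.linearMap_apply]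
    by_cases hg : g = 1
    · subst hg
      simp [one_def, mul_assoc]
    · have : ∀ h : G, ¬ h = x * (x⁻¹ * (h⁻¹ * g)⁻¹ * x) * x⁻¹ := fun h hh => hg (by
        have h2 : g⁻¹ * h = h := by simpa [mul_assoc] using hh.symm
        simpa using h2)
      simp only [this, hg, if_false, Finset.sum_const_zero, map_zero]

/-- The normalized integral `Λ = |G|⁻¹ ∑_x e_1 ⊗ x` of `D(G)`. -/
def integral (G : Type*) [Group G] [Fintype G] : DrinfeldDouble G :=
  (Fintype.card G : ℂ)⁻¹ • ∑ x : G, e 1 x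

end DrinfeldDouble

section HopfAlgebra

variable {H : Type*} [Ring H] [HopfAlgebra ℂ H]

/-- `Λ` is a normalized (two-sided) integral of the Hopf algebra `H`:
`hΛ = ε(h)Λ = Λh` for all `h ∈ H`, and `ε(Λ) = 1`. -/
structure IsNormalizedIntegral (Λ : H) : Prop where
  mul_left : ∀ h : H, h * Λ = Coalgebra.counit (R := ℂ) h • Λ
  mul_right : ∀ h : H, Λ * h = Coalgebra.counit (R := ℂ) h • Λ
  counit_eq_one : Coalgebra.counit (R := ℂ) Λ = 1

theorem IsNormalizedIntegral.unique {Λ Λ' : H} (h : IsNormalizedIntegral Λ)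
    (h' : IsNormalizedIntegral Λ') : Λ = Λ' := by
  have h1 := h.mul_right Λ'
  rw [h'.mul_left, h.counit_eq_one, h'.counit_eq_one, one_smul, one_smul] at h1
  exact h1.symm

/-- The Sweedler power map `h ↦ h^{[n]} = h₁ h₂ ⋯ hₙ`, where `h₁ ⊗ ⋯ ⊗ hₙ` is the iterated
coproduct of `h`: one has `h^{[0]} = ε(h) 1` and `h^{[n+1]} = (h₁)^{[n]} h₂`. -/
def sweedlerPow (H : Type*) [Ring H] [HopfAlgebra ℂ H] : ℕ → H →ₗ[ℂ] H
  | 0 => Algebra.linearMap ℂ H ∘ₗ Coalgebra.counit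
  | n + 1 => LinearMap.mul' ℂ H ∘ₗ (sweedlerPow H n).rTensor H ∘ₗ Coalgebra.comul

/-- The character of an `H`-module `V`: `h ↦ tr (v ↦ h v)`. -/
def moduleCharacter (V : Type*) [AddCommGroup V] [Module ℂ V] [Module H V] [IsScalarTower ℂ H V]
    (h : H) : ℂ :=
  LinearMap.trace ℂ V (Algebra.lsmul ℂ ℂ V h)

end HopfAlgebra

namespace DrinfeldDouble

variable {G : Type*} [Group G] [Fintype G] [DecidableEq G]

theorem isNormalizedIntegral_integral : IsNormalizedIntegral (integral G) where
  mul_left a := by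
    induction a using induction_on with
    | hadd a b h h' => rw [add_mul, h, h', map_add, add_smul]
    | hsmul r a h => rw [smul_mul_assoc, h, map_smul, smul_smul, smul_eq_mul]
    | he g x =>
      have hd : Coalgebra.counit (R := ℂ) (e g x) = if g = 1 then 1 else 0 := counit_e g x
      simp only [integral, hd, mul_smul_comm, Finset.mul_sum, e_mul_e, mul_one, mul_inv_cancel]
      by_cases hg : g = 1
      · subst hg
        simp only [if_true, one_smul]
        congr 1
        exact Fintype.sum_equiv (Equiv.mulLeft x) _ _ fun y => rfl
      · simp [hg]
  mul_right a := by
    induction a using induction_on with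
    | hadd a b h h' => rw [mul_add, h, h', map_add, add_smul]
    | hsmul r a h => rw [mul_smul_comm, h, map_smul, smul_smul, smul_eq_mul]
    | he g x =>
      have hd : Coalgebra.counit (R := ℂ) (e g x) = if g = 1 then 1 else 0 := counit_e g x
      simp only [integral, hd, smul_mul_assoc, Finset.sum_mul, e_mul_e]
      by_cases hg : g = 1
      · subst hg
        simp only [mul_one, mul_inv_cancel, if_true, one_smul]
        congr 1
        exact Fintype.sum_equiv (Equiv.mulRight x) _ _ fun y => rfl
      · have : ∀ y : G, ¬ (1 : G) = y * g * y⁻¹ := fun y hy => hg (by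
          have := congrArg (fun t => y⁻¹ * t * y) hy
          simpa [mul_assoc] using this.symm)
        simp [hg, this]
  counit_eq_one := by
    have hd : ∀ x : G, Coalgebra.counit (R := ℂ) (e 1 x) = 1 := fun x => by
      have := counit_e (1 : G) x
      rwa [if_pos rfl] at this
    simp [integral, hd]

/-- Irreducible representations of `D(G)` are automatically finite-dimensional. -/
theorem finiteDimensional_of_isSimpleModule (V : Type*) [AddCommGroup V] [Module ℂ V]
    [Module (DrinfeldDouble G) V] [IsScalarTower ℂ (DrinfeldDouble G) V]
    [IsSimpleModule (DrinfeldDouble G) V] : FiniteDimensional ℂ V := by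
  have : Nontrivial V := IsSimpleModule.nontrivial (DrinfeldDouble G) V
  obtain ⟨v, hv⟩ := exists_ne (0 : V)
  have hs := IsSimpleModule.toSpanSingleton_surjective (DrinfeldDouble G) hv
  exact Module.Finite.of_surjective
    ((LinearMap.toSpanSingleton (DrinfeldDouble G) V v).restrictScalars ℂ) hs

/-- The `n`-th Frobenius-Schur indicator `ν_n(V) = χ_V(Λ^{[n]})` of a representation `V` of
`D(G)`. -/
def indicator (n : ℕ) (V : Type*) [AddCommGroup V] [Module ℂ V] [Module (DrinfeldDouble G) V]
    [IsScalarTower ℂ (DrinfeldDouble G) V] : ℂ :=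
  moduleCharacter V (sweedlerPow (DrinfeldDouble G) n (integral G))

end DrinfeldDouble

/-- `G` is an `FSZ_n`-group: the `n`-th Frobenius-Schur indicator of every irreducible
representation of `D(G)` is an integer. -/
def IsFSZn (n : ℕ) (G : Type u) [Group G] [Fintype G] [DecidableEq G] : Prop :=
  ∀ (V : Type v) [AddCommGroup V] [Module ℂ V] [Module (DrinfeldDouble G) V]
    [IsScalarTower ℂ (DrinfeldDouble G) V] [IsSimpleModule (DrinfeldDouble G) V],
    ∃ k : ℤ, DrinfeldDouble.indicator (G := G) n V = (k : ℂ)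

/-- `G` is an `FSZ`-group: it is an `FSZ_n`-group for every positive integer `n`. -/
def IsFSZ (G : Type u) [Group G] [Fintype G] [DecidableEq G] : Prop :=
  ∀ n : ℕ, 0 < n → IsFSZn.{u, v} n G

end

/-!
Let `G` be a finite group and write `G_n(u, z)` for the set of `a` with `a ^ n = z = (a * u) ^ n`.
Expanding the Sweedler power of the integral gives
`ν_n(V) = |G|⁻¹ ∑_{h, z} |G_n(h⁻¹, z)| χ_V(e_h z)`.

The indicator is an algebraic integer, since it is the trace of the cyclic rotation on the
invariants of the `n`-th tensor power of `V`, an operator of finite order. It is rational if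
`|G_n(u, z)|` does not change when `z` is replaced by a power `z ^ m` with `m` prime to `|G|`: when
averaging over `m`, the inner sums become sums over `m` prime to `|G|` of the traces of `T ^ m`,
where `T` is the action of `e_h z`, and these are integers by inclusion-exclusion from the sums over
all powers, which are multiples of traces of projections.

For permutations the invariance of `|G_n(u, z)|` comes from an injection from `G_n(u, z)` to
`G_n(u, z ^ m)`, which multiplies `a` by the permutation `x ↦ z ^ ((m - 1) g(x)) x` for a
`z`-invariant integer weight `g`. It works if, at every point, the sums of `g` along `n` steps of
`a` and of `a * u` are `1` modulo the length of the `z`-cycle. If all `z`-cycles have length `k`,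
write `n = l r` where `l` has only prime divisors of `k` and `r` is prime to `k`; then `a ^ r` and
`(a * u) ^ r` have all their cycles of length `l k`, and by Hall's marriage theorem there is a set
meeting each cycle of either of them exactly once. Summed along `z`-cycles and multiplied by an
inverse of `r` modulo `k`, its indicator function is the required weight. Since `a` and its image
admit the same weights, the image determines the weight chosen for `a`, and hence `a` itself.
-/

section Permutations

open Function Finset

theorem bijOn_range_of_bijective_comp {α β γ : Type*} {f : β → γ} {s : α → β}
    (h : Bijective (f ∘ s)) : (Set.range s).BijOn f Set.univ :=
  ⟨Set.mapsTo_univ _ _, h.1.injOn_range, fun c _ => by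
    obtain ⟨a, rfl⟩ := h.2 c
    exact ⟨s a, ⟨a, rfl⟩, rfl⟩⟩

theorem exists_common_transversal {X α β : Type*} [Fintype X] [DecidableEq α] [DecidableEq β]
    {f : X → α} {g : X → β} {B : ℕ} (hB : 0 < B)
    (hf : ∀ a, #{x | f x = a} = B) (hg : ∀ b, #{x | g x = b} = B) :
    ∃ S : Set X, S.BijOn f Set.univ ∧ S.BijOn g Set.univ := by
  have := Fintype.ofSurjective f fun a => by
    simpa [Finset.Nonempty] using card_pos.1 (hB.trans_eq (hf a).symm)
  have := Fintype.ofSurjective g fun b => by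
    simpa [Finset.Nonempty] using card_pos.1 (hB.trans_eq (hg b).symm)
  have card_preimage_f (A : Finset α) : #{x | f x ∈ A} = #A * B := by
    simp [← sum_card_fiberwise_eq_card_filter, hf]
  have card_preimage_g (A : Finset β) : #{x | g x ∈ A} = #A * B := by
    simp [← sum_card_fiberwise_eq_card_filter, hg]
  have marriage (A : Finset α) : #A ≤ #{b | ∃ a ∈ A, ∃ x, f x = a ∧ g x = b} := by
    refine Nat.le_of_mul_le_mul_right ?_ hB
    rw [← card_preimage_f, ← card_preimage_g]
    exact card_le_card fun x hx => by simpa using ⟨x, (mem_filter.1 hx).2, rfl⟩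
  obtain ⟨t, ht, hft⟩ := (Fintype.all_card_le_filter_rel_iff_exists_injective _).1 marriage
  choose s hfs hgs using hft
  have card_eq : Fintype.card α = Fintype.card β := by
    have h := (card_preimage_f univ).symm.trans ((by simp) : _ = #{x | g x ∈ univ})
    rw [card_preimage_g] at h
    exact Nat.eq_of_mul_eq_mul_right hB h
  have ht_bij : Bijective t := (Fintype.bijective_iff_injective_and_card t).2 ⟨ht, card_eq⟩
  exact ⟨Set.range s, bijOn_range_of_bijective_comp ((funext hfs : f ∘ s = id) ▸ bijective_id),
    bijOn_range_of_bijective_comp ((funext hgs : g ∘ s = t) ▸ ht_bij)⟩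

theorem birkhoffSum_minimalPeriod {X M : Type*} [Fintype X] [DecidableEq X] [AddCommMonoid M]
    {p : X → X} (hp : ∀ x, x ∈ periodicPts p) (φ : X → M) (x : X) :
    birkhoffSum p φ (minimalPeriod p x) x =
      ∑ y with periodicOrbit p y = periodicOrbit p x, φ y := by
  have orbit_eq : ({y | periodicOrbit p y = periodicOrbit p x} : Finset X) =
      (range (minimalPeriod p x)).image (p^[·] x) := by
    ext y
    simp only [mem_filter, mem_univ, true_and, mem_image, mem_range]
    constructor
    · intro h
      obtain ⟨n, rfl⟩ := (mem_periodicOrbit_iff (hp x)).1 <| h ▸ self_mem_periodicOrbit (hp y)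
      exact ⟨n % minimalPeriod p x, Nat.mod_lt _ <| minimalPeriod_pos_of_mem_periodicPts (hp x),
        iterate_mod_minimalPeriod_eq⟩
    · rintro ⟨n, -, rfl⟩
      exact periodicOrbit_apply_iterate_eq (hp x) n
  rw [orbit_eq, sum_image fun i hi j hj => iterate_injOn_Iio_minimalPeriod
    (by simpa using hi) (by simpa using hj), birkhoffSum]

theorem exists_birkhoffSum_eq_one {X : Type*} [Finite X] {p q : X → X} {B : ℕ} (hB : 0 < B)
    (hp : ∀ x, minimalPeriod p x = B) (hq : ∀ x, minimalPeriod q x = B) :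
    ∃ h : X → ℤ, birkhoffSum p h B = 1 ∧ birkhoffSum q h B = 1 := by
  classical
  have := Fintype.ofFinite X
  let cycle (p : X → X) : X → Set.range (periodicOrbit p) := Set.rangeFactorization _
  have cycle_eq {p : X → X} {x y : X} :
      cycle p y = cycle p x ↔ periodicOrbit p y = periodicOrbit p x :=
    Subtype.ext_iff
  have birkhoffSum_eq {p : X → X} (hp : ∀ x, minimalPeriod p x = B) (h : X → ℤ) (x : X) :
      birkhoffSum p h B x = ∑ y with cycle p y = cycle p x, h y := by
    simp only [cycle_eq]
    rw [← birkhoffSum_minimalPeriod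
      (fun x => minimalPeriod_pos_iff_mem_periodicPts.1 (hB.trans_eq (hp x).symm)), hp]
  have card_cycle {p : X → X} (hp : ∀ x, minimalPeriod p x = B) :
      ∀ c, #{y | cycle p y = c} = B := by
    rintro ⟨_, x, rfl⟩
    have h := birkhoffSum_eq hp 1 x
    simp only [birkhoffSum, Pi.one_apply, sum_const, card_range, nsmul_eq_mul, mul_one] at h
    exact_mod_cast h.symm
  obtain ⟨S, hSp, hSq⟩ := exists_common_transversal hB (card_cycle hp) (card_cycle hq)
  have birkhoffSum_indicator {p : X → X} (hp : ∀ x, minimalPeriod p x = B)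
      (hS : S.BijOn (cycle p) Set.univ) : birkhoffSum p (S.indicator (1 : X → ℤ)) B = 1 := by
    ext x
    obtain ⟨y, hyS, hyx⟩ := hS.surjOn (Set.mem_univ (cycle p x))
    rw [birkhoffSum_eq hp, sum_eq_single_of_mem y (by simp [hyx])]
    · simp [hyS]
    · intro w hw hwy
      refine Set.indicator_of_notMem (fun hwS => hwy <| hS.injOn hwS hyS ?_) _
      exact (mem_filter.1 hw).2.trans hyx.symm
  exact ⟨S.indicator 1, birkhoffSum_indicator hp hSp, birkhoffSum_indicator hq hSq⟩

theorem birkhoffSum_mul {X M : Type*} [AddCommMonoid M] (f : X → X) (φ : X → M) (m n : ℕ) :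
    birkhoffSum f φ (m * n) = birkhoffSum f^[m] (birkhoffSum f φ m) n := by
  induction n with
  | zero => simp
  | succ n ih =>
    ext x
    rw [mul_add_one, birkhoffSum_add, ih, birkhoffSum_succ, iterate_mul]

theorem birkhoffSum_birkhoffSum_iterate {X M : Type*} [AddCommMonoid M] (f : X → X) (φ : X → M)
    (m n : ℕ) : birkhoffSum f (birkhoffSum f^[m] φ n) m = birkhoffSum f φ (m * n) := by
  ext x
  rw [birkhoffSum_mul]
  simp only [birkhoffSum, ← iterate_add_apply, ← iterate_mul]
  rw [sum_comm]
  simp only [add_comm]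

theorem exists_mul_eq_coprime (k : ℕ) {n : ℕ} (hn : n ≠ 0) :
    ∃ l m : ℕ, l * m = n ∧ (∀ r, r.Prime → r ∣ l → r ∣ k) ∧ m.Coprime k := by
  induction n using Nat.recOnMul with
  | zero => contradiction
  | one => exact ⟨1, 1, rfl, fun r hr h => absurd h hr.not_dvd_one, k.coprime_one_left⟩
  | prime p hp =>
    by_cases hpk : p ∣ k
    · exact ⟨p, 1, mul_one p, fun r hr h => (Nat.prime_dvd_prime_iff_eq hr hp).1 h ▸ hpk,
        k.coprime_one_left⟩
    · exact ⟨1, p, one_mul p, fun r hr h => absurd h hr.not_dvd_one,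
        (hp.coprime_iff_not_dvd).2 hpk⟩
  | mul a b iha ihb =>
    obtain ⟨l, m, rfl, hl, hm⟩ := iha (left_ne_zero_of_mul hn)
    obtain ⟨l', m', rfl, hl', hm'⟩ := ihb (right_ne_zero_of_mul hn)
    exact ⟨l * l', m * m', by ring, fun r hr h => (hr.dvd_mul.1 h).elim (hl r hr) (hl' r hr),
      hm.mul_left hm'⟩

theorem minimalPeriod_eq_mul {X : Type*} {f : X → X} {l : ℕ} {x : X} (hx : x ∈ periodicPts f)
    (hl : ∀ r, r.Prime → r ∣ l → r ∣ minimalPeriod f^[l] x) :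
    minimalPeriod f x = l * minimalPeriod f^[l] x := by
  have pos := minimalPeriod_pos_of_mem_periodicPts hx
  have h := minimalPeriod_iterate_eq_div_gcd' (n := l) hx
  have gcd_eq : (minimalPeriod f x).gcd l = l := by
    refine (Nat.eq_of_dvd_of_div_eq_one (Nat.gcd_dvd_right _ _) <|
      Nat.eq_one_iff_not_exists_prime_dvd.2 fun r hr hrl => hr.not_dvd_one ?_)
    rw [← Nat.coprime_div_gcd_div_gcd (Nat.gcd_pos_of_pos_left l pos)]
    exact Nat.dvd_gcd (h ▸ hl r hr (hrl.trans (Nat.div_dvd_of_dvd (Nat.gcd_dvd_right _ _)))) hrl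
  rw [h, gcd_eq, Nat.mul_div_cancel' (gcd_eq ▸ Nat.gcd_dvd_left _ _)]

theorem exists_weight_of_minimalPeriod_eq {X : Type*} [Finite X] {a b z : X → X} {n k : ℕ}
    (hn : n ≠ 0) (hk : 0 < k) (ha : a^[n] = z) (hb : b^[n] = z) (hz : ∀ x, minimalPeriod z x = k) :
    ∃ g : X → ℤ, g ∘ z = g ∧
      ∀ x, birkhoffSum a g n x ≡ 1 [ZMOD k] ∧ birkhoffSum b g n x ≡ 1 [ZMOD k] := by
  obtain ⟨l, m, rfl, hl, hm⟩ := exists_mul_eq_coprime k hn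
  have minimalPeriod_root {a : X → X} (ha : a^[l * m] = z) (x : X) :
      minimalPeriod a^[m] x = l * k := by
    have ha' : (a^[m])^[l] = z := by rw [← iterate_mul, mul_comm, ha]
    have hx : x ∈ periodicPts z := minimalPeriod_pos_iff_mem_periodicPts.1 (hk.trans_eq (hz x).symm)
    have hxa : x ∈ periodicPts a^[m] := by
      obtain ⟨t, ht, hxt⟩ := hx
      refine ⟨l * t, Nat.mul_pos (Nat.pos_of_ne_zero (left_ne_zero_of_mul hn)) ht, ?_⟩
      rwa [IsPeriodicPt, iterate_mul, ha']
    rw [minimalPeriod_eq_mul hxa, ha', hz]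
    rwa [ha', hz]
  obtain ⟨h, hha, hhb⟩ := exists_birkhoffSum_eq_one
    (Nat.mul_pos (Nat.pos_of_ne_zero (left_ne_zero_of_mul hn)) hk)
    (minimalPeriod_root ha) (minimalPeriod_root hb)
  obtain ⟨c, hc⟩ := Int.mod_coprime hm
  have birkhoffSum_root {a : X → X} (ha : a^[l * m] = z) (hha : birkhoffSum a^[m] h (l * k) = 1)
      (x : X) : birkhoffSum a (fun y => birkhoffSum z h k y * c) (l * m) x ≡ 1 [ZMOD k] := by
    calc birkhoffSum a (fun y => birkhoffSum z h k y * c) (l * m) x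
        = birkhoffSum a (birkhoffSum a^[l * m] h k) (l * m) x * c := by
          simp only [birkhoffSum, sum_mul, ha]
      _ = birkhoffSum a (birkhoffSum a^[m] h (l * k)) m x * c := by
          rw [birkhoffSum_birkhoffSum_iterate, birkhoffSum_birkhoffSum_iterate,
            mul_comm l m, mul_assoc]
      _ = m * c := by rw [hha]; simp [birkhoffSum]
      _ ≡ 1 [ZMOD k] := hc
  refine ⟨fun y => birkhoffSum z h k y * c, ?_,
    fun x => ⟨birkhoffSum_root ha hha x, birkhoffSum_root hb hhb x⟩⟩
  ext x
  have hx : z^[k] x = x := hz x ▸ iterate_minimalPeriod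
  have := birkhoffSum_apply_sub_birkhoffSum z h k x
  rw [hx, sub_self, sub_eq_zero] at this
  simp [this]

theorem birkhoffSum_apply_of_semiconj {α β M : Type*} [AddCommMonoid M] {π : α → β} {fa : α → α}
    {fb : β → β} (h : Semiconj π fa fb) (φ : β → M) (n : ℕ) (x : α) :
    birkhoffSum fb φ n (π x) = birkhoffSum fa (φ ∘ π) n x := by
  simp only [birkhoffSum, comp_apply, (h.iterate_right _).eq]

theorem minimalPeriod_apply_of_commute {X : Type*} {a z : X → X} (ha : Injective a)
    (h : Function.Commute a z) (x : X) : minimalPeriod z (a x) = minimalPeriod z x := by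
  rw [minimalPeriod_eq_minimalPeriod_iff]
  intro n
  rw [IsPeriodicPt, IsFixedPt, ← (h.iterate_right n).eq, ha.eq_iff, IsPeriodicPt, IsFixedPt]

theorem minimalPeriod_restrict {X : Type*} {s : Set X} {z : X → X} (hz : s.MapsTo z s) (x : s) :
    minimalPeriod (hz.restrict z s s) x = minimalPeriod z x := by
  rw [minimalPeriod_eq_minimalPeriod_iff]
  intro n
  rw [IsPeriodicPt, IsFixedPt, IsPeriodicPt, IsFixedPt, hz.iterate_restrict, Subtype.ext_iff,
    Set.MapsTo.val_restrict_apply]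

/-- The integer-valued functions that are constant on the orbits of `z`, as a group. -/
def invariantWeights {X : Type*} (z : X → X) : AddSubgroup (X → ℤ) where
  carrier := {g | g ∘ z = g}
  add_mem' {g h} hg hh := by
    change g ∘ z + h ∘ z = g + h
    rw [hg, hh]
  zero_mem' := rfl
  neg_mem' {g} hg := congrArg Neg.neg hg

/-- The `z`-invariant weights whose sum along `n` steps of `a`, read as an exponent of `z`, acts as
`1` at every point: if `a ^ n = z`, they are the weights `g` for which moving by `z ^ g` along the
orbit of `a` turns `a` into an `n`-th root of other powers of `z`. -/
def rootWeights {X : Type*} (n : ℕ) (z a : X → X) : Set (invariantWeights z) :=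
  {g | ∀ x, birkhoffSum a g n x ≡ 1 [ZMOD minimalPeriod z x]}

theorem rootWeights_inter_nonempty {X : Type*} [Finite X] {a b z : X → X} {n : ℕ} (hn : n ≠ 0)
    (ha_inj : Injective a) (hb_inj : Injective b) (ha : a^[n] = z) (hb : b^[n] = z) :
    (rootWeights n z a ∩ rootWeights n z b).Nonempty := by
  have hz_inj : Injective z := ha ▸ ha_inj.iterate n
  have pos (x : X) : 0 < minimalPeriod z x :=
    minimalPeriod_pos_of_mem_periodicPts (hz_inj.mem_periodicPts x)
  let Y (k : ℕ) : Set X := {x | minimalPeriod z x = k}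
  have mapsTo {f : X → X} (hf : Injective f) (hfz : Function.Commute f z) (k : ℕ) :
      (Y k).MapsTo f (Y k) :=
    fun x hx => (minimalPeriod_apply_of_commute hf hfz x).trans hx
  have mapsTo_z := mapsTo hz_inj (Function.Commute.refl z)
  have mapsTo_a := mapsTo ha_inj (ha ▸ Function.Commute.self_iterate a n)
  have mapsTo_b := mapsTo hb_inj (hb ▸ Function.Commute.self_iterate b n)
  choose G hGz hG using fun k hk => exists_weight_of_minimalPeriod_eq hn hk
    (a := (mapsTo_a k).restrict) (b := (mapsTo_b k).restrict) (z := (mapsTo_z k).restrict)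
    (by rw [Set.MapsTo.iterate_restrict]; congr)
    (by rw [Set.MapsTo.iterate_restrict]; congr)
    (fun x => (minimalPeriod_restrict _ x).trans x.2)
  let g (x : X) : ℤ := G _ (pos x) ⟨x, rfl⟩
  have g_comp_val {k : ℕ} (hk : 0 < k) : g ∘ Subtype.val = G k hk := by
    funext ⟨x, hx⟩
    obtain rfl := hx
    rfl
  have semiconj {f : X → X} {k : ℕ} (hf : (Y k).MapsTo f (Y k)) :
      Semiconj Subtype.val hf.restrict f := fun _ => rfl
  have birkhoffSum_g {f : X → X} (hf : ∀ k, (Y k).MapsTo f (Y k)) (x : X) :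
      birkhoffSum f g n x = birkhoffSum (hf _).restrict (G _ (pos x)) n ⟨x, rfl⟩ := by
    rw [← g_comp_val, ← birkhoffSum_apply_of_semiconj (semiconj (hf _))]
  refine ⟨⟨g, funext fun x => ?_⟩, fun x => ?_, fun x => ?_⟩
  · have h := congrFun (hGz _ (pos x)) ⟨x, rfl⟩
    rwa [← g_comp_val] at h
  · exact birkhoffSum_g mapsTo_a x ▸ (hG _ (pos x) _).1
  · exact birkhoffSum_g mapsTo_b x ▸ (hG _ (pos x) _).2

theorem commute_of_pow_eq {M : Type*} [Monoid M] {a z : M} {n : ℕ} (h : a ^ n = z) :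
    _root_.Commute a z :=
  h ▸ (_root_.Commute.refl a).pow_right n

section Twist

open Equiv

variable {X : Type*} {a z : Perm X} {n : ℕ}

theorem zpow_apply_eq_of_modEq {s t : ℤ} {x : X} (h : s ≡ t [ZMOD minimalPeriod z x]) :
    (z ^ s) x = (z ^ t) x := by
  have := (MulAction.zpow_smul_eq_iff_minimalPeriod_dvd (a := z) (b := x)).2 h.symm.dvd
  rw [← sub_add_cancel s t, add_comm, zpow_add, Perm.mul_apply]
  exact congrArg _ this

theorem invariantWeights_apply_zpow (g : invariantWeights z) (t : ℤ) (x : X) :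
    g.1 ((z ^ t) x) = g.1 x := by
  have step (x : X) : g.1 (z x) = g.1 x := congrFun g.2 x
  induction t with
  | zero => simp
  | succ t ih => rw [add_comm, zpow_add, zpow_one, Perm.mul_apply, step, ih]
  | pred t ih => rw [← step, ← Perm.mul_apply, ← zpow_one_add, add_sub_cancel, ih]

/-- The permutation moving each point `x` by the power `z ^ g x` along its `z`-orbit. -/
def twist (z : Perm X) (g : invariantWeights z) : Perm X where
  toFun x := (z ^ g.1 x) x
  invFun x := (z ^ (-g.1 x)) x
  left_inv x := by simp [invariantWeights_apply_zpow]
  right_inv x := by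
    beta_reduce
    rw [invariantWeights_apply_zpow]
    simp

theorem twist_apply (g : invariantWeights z) (x : X) : twist z g x = (z ^ g.1 x) x := rfl

theorem twist_mul_iterate_apply (h : _root_.Commute a z) (g : invariantWeights z) (i : ℕ) (x : X) :
    (twist z g * a)^[i] x = (z ^ birkhoffSum a g.1 i (a x)) (a^[i] x) := by
  induction i with
  | zero => simp
  | succ i ih =>
    have comm (t : ℤ) (y : X) : a ((z ^ t) y) = (z ^ t) (a y) :=
      Equiv.congr_fun (h.zpow_right t).eq y
    rw [iterate_succ_apply', ih, Perm.mul_apply, comm, twist_apply, invariantWeights_apply_zpow,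
      ← Perm.mul_apply, ← zpow_add, birkhoffSum_succ, add_comm, iterate_succ_apply',
      ← iterate_succ_apply, iterate_succ_apply']

theorem rootWeights_twist_mul (h : _root_.Commute a z) (g : invariantWeights z) :
    rootWeights n z (twist z g * a) = rootWeights n z a := by
  ext g'
  simp only [rootWeights, birkhoffSum, twist_mul_iterate_apply h, invariantWeights_apply_zpow]

theorem twist_mul_pow (ha : a ^ n = z) {g : invariantWeights z} (hg : g ∈ rootWeights n z a)
    (m : ℕ) : (twist z ((m - 1 : ℤ) • g) * a) ^ n = z ^ m := by
  have hc := commute_of_pow_eq ha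
  ext x
  have period_eq : minimalPeriod z (a x) = minimalPeriod z (z x) := by
    rw [minimalPeriod_apply_of_commute a.injective fun y => Equiv.congr_fun hc.eq y,
      minimalPeriod_apply_of_commute z.injective fun _ => rfl]
  have shift : birkhoffSum a ((m - 1 : ℤ) • g).1 n (a x) ≡ m - 1 [ZMOD minimalPeriod z (z x)] := by
    have h := (period_eq ▸ hg (a x)).mul_left (m - 1)
    rwa [mul_one, birkhoffSum, mul_sum] at h
  have root_apply : a^[n] x = z x := by rw [Perm.iterate_eq_pow, ha]
  rw [← Perm.iterate_eq_pow, twist_mul_iterate_apply hc, root_apply, zpow_apply_eq_of_modEq shift,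
    ← Perm.mul_apply, ← zpow_add_one, sub_add_cancel, zpow_natCast]

end Twist

section CommonRoots

section Group

variable {G : Type*} [Group G] [Fintype G] [DecidableEq G] {n : ℕ} {u z a : G}

/-- The elements `a` such that both `a` and `a * u` are `n`-th roots of `z`: in the notation of
Iovanov, Mason and Montgomery, the set `G_n(u, z)`. -/
def commonRoots (n : ℕ) (u z : G) : Finset G := {a | a ^ n = z ∧ (a * u) ^ n = z}

theorem mem_commonRoots : a ∈ commonRoots n u z ↔ a ^ n = z ∧ (a * u) ^ n = z := by
  simp [commonRoots]

theorem commute_of_mem_commonRoots (ha : a ∈ commonRoots n u z) : _root_.Commute u z := by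
  obtain ⟨ha, hau⟩ := mem_commonRoots.1 ha
  simpa using (commute_of_pow_eq ha).inv_left.mul_left (commute_of_pow_eq hau)

end Group

open Equiv

variable {X : Type*} [Fintype X] [DecidableEq X] {n : ℕ}

theorem card_commonRoots_le_card_commonRoots_pow (hn : n ≠ 0) (u z : Perm X) (m : ℕ) :
    #(commonRoots n u z) ≤ #(commonRoots n u (z ^ m)) := by
  let weights (a : Perm X) : Set (invariantWeights z) := rootWeights n z a ∩ rootWeights n z (a * u)
  let weight (a : Perm X) : invariantWeights z := Classical.epsilon (· ∈ weights a)
  have weight_mem {a : Perm X} (ha : a ∈ commonRoots n u z) : weight a ∈ weights a := by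
    obtain ⟨ha, hau⟩ := mem_commonRoots.1 ha
    refine Classical.epsilon_spec <|
      rootWeights_inter_nonempty hn a.injective (a * u).injective ?_ ?_
    · rw [Perm.iterate_eq_pow, ha]
    · rw [Perm.iterate_eq_pow, hau]
  let f (a : Perm X) : Perm X := twist z ((m - 1 : ℤ) • weight a) * a
  have weight_f {a : Perm X} (ha : a ∈ commonRoots n u z) : weight (f a) = weight a := by
    obtain ⟨ha, hau⟩ := mem_commonRoots.1 ha
    simp only [weight, weights, f, mul_assoc, rootWeights_twist_mul (commute_of_pow_eq ha),
      rootWeights_twist_mul (commute_of_pow_eq hau)]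
  refine card_le_card_of_injOn f (fun a ha => ?_) (fun a ha b hb hab => ?_)
  · have ha' := mem_commonRoots.1 ha
    have hw := weight_mem ha
    refine mem_commonRoots.2 ⟨twist_mul_pow ha'.1 hw.1 m, ?_⟩
    rw [mul_assoc]
    exact twist_mul_pow ha'.2 hw.2 m
  · have hw : weight a = weight b := by rw [← weight_f ha, hab, weight_f hb]
    simp only [f, hw] at hab
    exact mul_left_cancel hab

theorem card_commonRoots_pow_of_coprime (hn : n ≠ 0) (u : Perm X) {z : Perm X} {m : ℕ}
    (hm : m.Coprime (orderOf z)) : #(commonRoots n u (z ^ m)) = #(commonRoots n u z) := by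
  obtain ⟨m', hm'⟩ := exists_pow_eq_self_of_coprime hm
  refine le_antisymm ?_ (card_commonRoots_le_card_commonRoots_pow hn u z m)
  calc #(commonRoots n u (z ^ m)) ≤ #(commonRoots n u ((z ^ m) ^ m')) :=
        card_commonRoots_le_card_commonRoots_pow hn u _ m'
    _ = #(commonRoots n u z) := by rw [hm']

end CommonRoots

end Permutations

section Indicators

open Finset

theorem sum_filter_gcd_eq {M : Type*} [AddCommMonoid M] {n d : ℕ} (hn : 0 < n) (hd : d ∣ n)
    (f : ℕ → M) :
    ∑ m ∈ Ioc 0 n with n.gcd m = d, f m =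
      ∑ j ∈ Ioc 0 (n / d) with (n / d).Coprime j, f (d * j) := by
  obtain ⟨s, rfl⟩ := hd
  have hd0 : 0 < d := Nat.pos_of_mul_pos_right hn
  rw [Nat.mul_div_cancel_left s hd0]
  symm
  refine sum_nbij (d * ·) (fun j hj => ?_) (fun i _ j _ h => Nat.eq_of_mul_eq_mul_left hd0 h)
    (fun m hm => ?_) (fun _ _ => rfl)
  · simp only [mem_filter, mem_Ioc] at hj ⊢
    exact ⟨⟨Nat.mul_pos hd0 hj.1.1, Nat.mul_le_mul_left d hj.1.2⟩,
      by rw [Nat.gcd_mul_left, hj.2.gcd_eq_one, mul_one]⟩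
  · simp only [coe_filter, mem_Ioc, Set.mem_ofPred_eq] at hm
    obtain ⟨j, rfl⟩ : d ∣ m := hm.2 ▸ Nat.gcd_dvd_right _ _
    refine ⟨j, ?_, rfl⟩
    simp only [coe_filter, mem_Ioc, Set.mem_ofPred_eq]
    rw [Nat.gcd_mul_left] at hm
    exact ⟨⟨Nat.pos_of_mul_pos_left hm.1.1, Nat.le_of_mul_le_mul_left hm.1.2 hd0⟩,
      Nat.eq_of_mul_eq_mul_left hd0 (hm.2.trans (mul_one d).symm)⟩

theorem sum_filter_coprime_mem {M : Type*} [AddCommGroup M] (A : AddSubgroup M) {n : ℕ}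
    (hn : 0 < n) {f : ℕ → M} (hf : ∀ d, d ∣ n → ∑ j ∈ Ioc 0 (n / d), f (d * j) ∈ A) :
    ∑ m ∈ Ioc 0 n with n.Coprime m, f m ∈ A := by
  induction n using Nat.strong_induction_on generalizing f with
  | _ n ih =>
  have total : ∑ m ∈ Ioc 0 n, f m = ∑ d ∈ n.divisors, ∑ m ∈ Ioc 0 n with n.gcd m = d, f m :=
    (sum_fiberwise_of_maps_to
      (fun m _ => Nat.mem_divisors.2 ⟨Nat.gcd_dvd_left n m, hn.ne'⟩) f).symm
  have noncoprime (d : ℕ) (hd : d ∈ n.divisors.erase 1) :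
      ∑ m ∈ Ioc 0 n with n.gcd m = d, f m ∈ A := by
    obtain ⟨hd1, hdn, -⟩ := by simpa only [mem_erase, Nat.mem_divisors] using hd
    have hd0 : 0 < d := Nat.pos_of_dvd_of_pos hdn hn
    rw [sum_filter_gcd_eq hn hdn]
    refine ih _ (Nat.div_lt_self hn (by omega)) (Nat.div_pos (Nat.le_of_dvd hn hdn) hd0)
      fun c hc => ?_
    simpa only [Nat.div_div_eq_div_mul, mul_assoc] using hf _ (Nat.mul_dvd_of_dvd_div hdn hc)
  have coprime : ∑ m ∈ Ioc 0 n with n.Coprime m, f m =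
      ∑ m ∈ Ioc 0 n, f m - ∑ d ∈ n.divisors.erase 1, ∑ m ∈ Ioc 0 n with n.gcd m = d, f m := by
    rw [total, ← add_sum_erase _ _ (Nat.one_mem_divisors.2 hn.ne'), add_sub_cancel_right]
  rw [coprime]
  exact A.sub_mem (by simpa using hf 1 (one_dvd n)) (A.sum_mem noncoprime)

theorem pow_add_eq_of_pow_succ_eq {M : Type*} [Monoid M] {a : M} {n d : ℕ} (ha : a ^ (n + 1) = a)
    (hd : d ≠ 0) : a ^ (n + d) = a ^ d := by
  obtain ⟨d, rfl⟩ := Nat.exists_eq_succ_of_ne_zero hd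
  rw [Nat.succ_eq_add_one, add_comm d, ← add_assoc, pow_add, ha, pow_add, pow_one]

theorem isIdempotentElem_average {ι K A : Type*} [Field K] [Ring A] [Algebra K A] {s : Finset ι}
    {f : ι → A} (hf : ∀ i ∈ s, f i * ∑ j ∈ s, f j = ∑ j ∈ s, f j) :
    IsIdempotentElem ((#s : K)⁻¹ • ∑ i ∈ s, f i) := by
  have sum_mul_sum : (∑ i ∈ s, f i) * ∑ i ∈ s, f i = (#s : K) • ∑ i ∈ s, f i := by
    rw [sum_mul, sum_congr rfl hf, sum_const, Nat.cast_smul_eq_nsmul]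
  rw [IsIdempotentElem, smul_mul_smul_comm, sum_mul_sum, smul_smul]
  congr 1
  simpa [mul_right_comm] using mul_inv_mul_cancel (#s : K)⁻¹

theorem isIdempotentElem_average_pow {K A : Type*} [Field K] [Ring A] [Algebra K A] {a : A} {n : ℕ}
    (ha : a ^ (n + 1) = a) : IsIdempotentElem ((n : K)⁻¹ • ∑ j ∈ Ioc 0 n, a ^ j) := by
  have mul_sum_pow : a * ∑ j ∈ Ioc 0 n, a ^ j = ∑ j ∈ Ioc 0 n, a ^ j := by
    have sum_eq : ∑ j ∈ Ioc 0 n, a ^ j = (∑ j ∈ range n, a ^ j) * a := by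
      rw [sum_mul]
      exact (sum_Ico_eq_sum_range (a ^ ·) 1 (n + 1)).trans
        (sum_congr rfl fun j _ => by rw [add_comm, pow_succ])
    rw [← sub_eq_zero, ← sub_one_mul, sum_eq, ← mul_assoc, mul_geom_sum, sub_one_mul, ← pow_succ,
      ha, sub_self]
  have pow_mul_sum_pow (j : ℕ) : a ^ j * ∑ i ∈ Ioc 0 n, a ^ i = ∑ i ∈ Ioc 0 n, a ^ i := by
    induction j with
    | zero => rw [pow_zero, one_mul]
    | succ j ih => rw [pow_succ, mul_assoc, mul_sum_pow, ih]
  simpa using isIdempotentElem_average (K := K) (s := Ioc 0 n) fun j _ => pow_mul_sum_pow j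

section Trace

variable {K V : Type*} [Field K] [AddCommGroup V] [Module K V] [FiniteDimensional K V]
  {T : Module.End K V}

theorem trace_mem_range_intCast_of_isIdempotentElem (hT : IsIdempotentElem T) :
    LinearMap.trace K V T ∈ (Int.castAddHom K).range :=
  ⟨_, (Int.cast_natCast _).trans (LinearMap.IsIdempotentElem.isProj_range T hT).trace.symm⟩

variable [CharZero K] {n : ℕ}

theorem sum_trace_pow_mem_range_intCast (hn : n ≠ 0) (hT : T ^ (n + 1) = T) :
    ∑ j ∈ Ioc 0 n, LinearMap.trace K V (T ^ j) ∈ (Int.castAddHom K).range := by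
  have h := AddSubgroup.nsmul_mem _ (trace_mem_range_intCast_of_isIdempotentElem
    (isIdempotentElem_average_pow (K := K) hT)) n
  rwa [map_smul, map_sum, ← Nat.cast_smul_eq_nsmul K, smul_inv_smul₀ (Nat.cast_ne_zero.2 hn)] at h

theorem sum_trace_pow_coprime_mem_range_intCast (hn : 0 < n) (hT : T ^ (n + 1) = T) :
    ∑ m ∈ Ioc 0 n with n.Coprime m, LinearMap.trace K V (T ^ m) ∈ (Int.castAddHom K).range := by
  refine sum_filter_coprime_mem _ hn fun d hd => ?_
  obtain ⟨s, rfl⟩ := hd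
  have hd0 : 0 < d := Nat.pos_of_mul_pos_right hn
  rw [Nat.mul_div_cancel_left s hd0]
  simp only [pow_mul]
  refine sum_trace_pow_mem_range_intCast (Nat.pos_of_mul_pos_left hn).ne' ?_
  rw [← pow_mul, mul_add_one, pow_add_eq_of_pow_succ_eq hT hd0.ne']

end Trace

theorem sum_sum_pow_coprime {G M : Type*} [Group G] [Fintype G] [AddCommMonoid M] {C : Finset ℕ}
    (hC : ∀ m ∈ C, (Fintype.card G).Coprime m) (f : G → M) :
    ∑ z, ∑ m ∈ C, f (z ^ m) = #C • ∑ z, f z := by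
  rw [sum_comm, ← sum_const]
  refine sum_congr rfl fun m hm => ?_
  exact (powCoprime (G := G) (n := m)
    (by rw [Nat.card_eq_fintype_card]; exact hC m hm)).sum_comp f

namespace DrinfeldDouble

variable {G : Type*} [Group G] [Fintype G] [DecidableEq G]

theorem sweedlerPow_zero_e (g x : G) :
    sweedlerPow (DrinfeldDouble G) 0 (e g x) = if g = 1 then 1 else 0 := by
  have hd : Coalgebra.counit (R := ℂ) (e g x) = if g = 1 then 1 else 0 := counit_e g x
  simp only [sweedlerPow, LinearMap.comp_apply, hd]
  split_ifs <;> simp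

theorem sweedlerPow_succ_e (n : ℕ) (g x : G) :
    sweedlerPow (DrinfeldDouble G) (n + 1) (e g x) =
      ∑ h : G, sweedlerPow (DrinfeldDouble G) n (e h x) * e (h⁻¹ * g) x := by
  have hc : CoalgebraStruct.comul (R := ℂ) (e g x) = ∑ h : G, e h x ⊗ₜ[ℂ] e (h⁻¹ * g) x :=
    comul_e g x
  simp only [sweedlerPow, LinearMap.comp_apply, hc, map_sum, LinearMap.rTensor_tmul,
    LinearMap.mul'_apply]

theorem sweedlerPow_e (n : ℕ) (g x : G) :
    sweedlerPow (DrinfeldDouble G) n (e g x) =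
      ∑ h : G, if (h * x⁻¹) ^ n * x ^ n = g then e h (x ^ n) else 0 := by
  induction n generalizing g with
  | zero =>
    simp only [sweedlerPow_zero_e, pow_zero, mul_one, eq_comm (a := (1 : G))]
    split_ifs <;> simp [one_def]
  | succ n ih =>
    simp only [sweedlerPow_succ_e, ih, sum_mul, ite_mul, zero_mul]
    rw [sum_comm]
    refine sum_congr rfl fun h _ => ?_
    rw [sum_ite_eq, if_pos (mem_univ _), e_mul_e, ← pow_succ]
    refine if_congr ?_ rfl rfl
    rw [eq_mul_inv_iff_mul_eq, mul_inv_rev, mul_assoc, mul_inv_cancel_left, eq_inv_mul_iff_mul_eq,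
      pow_succ, pow_succ' x, mul_assoc, mul_assoc h, inv_mul_cancel_left]

theorem e_pow {h z : G} (hz : Commute h z) {m : ℕ} (hm : m ≠ 0) : e h z ^ m = e h (z ^ m) := by
  induction m, Nat.one_le_iff_ne_zero.2 hm using Nat.le_induction with
  | base => simp only [pow_one]
  | succ m _ ih =>
    rw [pow_succ, ih (by omega), e_mul_e, if_pos, pow_succ]
    rw [← (hz.pow_right m).eq, mul_inv_cancel_right]

section Character

variable (V : Type*) [AddCommGroup V] [Module ℂ V] [Module (DrinfeldDouble G) V]
  [IsScalarTower ℂ (DrinfeldDouble G) V]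

theorem moduleCharacter_ite {p : Prop} [Decidable p] (a : DrinfeldDouble G) :
    moduleCharacter V (if p then a else 0) = if p then moduleCharacter V a else 0 := by
  split_ifs
  · rfl
  · simp only [moduleCharacter, map_zero]

theorem indicator_eq_sum_card_commonRoots (n : ℕ) :
    indicator (G := G) n V = (Fintype.card G : ℂ)⁻¹ *
      ∑ h : G, ∑ z : G, #(commonRoots n h⁻¹ z) * moduleCharacter V (e h z) := by
  have condition (h x z : G) :
      ((h * x⁻¹) ^ n * x ^ n = 1 ∧ x ^ n = z) ↔ x ∈ commonRoots n h⁻¹ z := by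
    rw [mem_commonRoots, and_comm]
    refine and_congr_right fun hx => ?_
    rw [hx, mul_eq_one_iff_eq_inv, ← inv_inj, ← inv_pow, mul_inv_rev, inv_inv, inv_inv]
  calc indicator (G := G) n V
      = (Fintype.card G : ℂ)⁻¹ * ∑ x : G, ∑ h : G,
          if (h * x⁻¹) ^ n * x ^ n = 1 then moduleCharacter V (e h (x ^ n)) else 0 := by
        simp only [indicator, integral, moduleCharacter, sweedlerPow_e, map_smul, map_sum,
          smul_eq_mul]
        congr! 4
        exact moduleCharacter_ite V _
    _ = (Fintype.card G : ℂ)⁻¹ * ∑ h : G, ∑ z : G, ∑ x : G,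
          if x ∈ commonRoots n h⁻¹ z then moduleCharacter V (e h z) else 0 := by
        rw [sum_comm]
        congr! 2 with h
        rw [sum_comm]
        simp only [← condition, ite_and]
        congr! 1 with x
        split_ifs <;> simp
    _ = _ := by simp [sum_ite_mem]

theorem sum_moduleCharacter_coprime_mem_range_intCast [FiniteDimensional ℂ V] {h z : G}
    (hz : Commute h z) :
    ∑ m ∈ Ioc 0 (Fintype.card G) with (Fintype.card G).Coprime m, moduleCharacter V (e h (z ^ m)) ∈
      (Int.castAddHom ℂ).range := by
  let T : Module.End ℂ V := Algebra.lsmul ℂ ℂ V (e h z)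
  have pow_T {m : ℕ} (hm : m ≠ 0) : T ^ m = Algebra.lsmul ℂ ℂ V (e h (z ^ m)) := by
    rw [← e_pow hz hm, map_pow]
  have T_pow_card : T ^ (Fintype.card G + 1) = T := by
    rw [pow_T (Nat.succ_ne_zero _), pow_succ, pow_card_eq_one, one_mul]
  convert sum_trace_pow_coprime_mem_range_intCast Fintype.card_pos T_pow_card using 3 with m hm
  rw [pow_T (mem_Ioc.1 (mem_filter.1 hm).1).1.ne', moduleCharacter]

theorem exists_rat_indicator_eq [FiniteDimensional ℂ V] (n : ℕ)
    (hG : ∀ (u z : G) (m : ℕ), (Fintype.card G).Coprime m →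
      #(commonRoots n u (z ^ m)) = #(commonRoots n u z)) :
    ∃ q : ℚ, indicator (G := G) n V = q := by
  set C := {m ∈ Ioc 0 (Fintype.card G) | (Fintype.card G).Coprime m} with hC
  have coprime {m : ℕ} (hm : m ∈ C) : (Fintype.card G).Coprime m := (mem_filter.1 hm).2
  have card_C_ne_zero : #C ≠ 0 :=
    (card_pos.2 ⟨1, by simp [hC, Nat.one_le_iff_ne_zero, Fintype.card_ne_zero]⟩).ne'
  let F (h z : G) : ℂ := #(commonRoots n h⁻¹ z) * moduleCharacter V (e h z)
  have averaged_mem (h z : G) : ∑ m ∈ C, F h (z ^ m) ∈ (Int.castAddHom ℂ).range := by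
    have F_pow : ∑ m ∈ C, F h (z ^ m) =
        #(commonRoots n h⁻¹ z) • ∑ m ∈ C, moduleCharacter V (e h (z ^ m)) := by
      rw [nsmul_eq_mul, mul_sum]
      exact sum_congr rfl fun m hm => by simp only [F, hG _ z m (coprime hm)]
    rw [F_pow]
    obtain h0 | ⟨a, ha⟩ := (commonRoots n h⁻¹ z).eq_empty_or_nonempty
    · simp [h0]
    · exact AddSubgroup.nsmul_mem _ (sum_moduleCharacter_coprime_mem_range_intCast V
        (Commute.inv_left_iff.1 (commute_of_mem_commonRoots ha))) _
  obtain ⟨k, hk⟩ : #C • ∑ h, ∑ z, F h z ∈ (Int.castAddHom ℂ).range := by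
    rw [smul_sum]
    refine sum_mem fun h _ => ?_
    rw [← sum_sum_pow_coprime fun m => coprime]
    exact sum_mem fun z _ => averaged_mem h z
  refine ⟨(Fintype.card G : ℚ)⁻¹ * ((#C : ℚ)⁻¹ * k), ?_⟩
  rw [indicator_eq_sum_card_commonRoots]
  push_cast
  congr 1
  rw [eq_inv_mul_iff_mul_eq₀ (Nat.cast_ne_zero.2 card_C_ne_zero), ← nsmul_eq_mul]
  exact hk.symm
end Character

end DrinfeldDouble

theorem isIntegral_of_pow_succ_eq {A : Type*} [Ring A] {a : A} {n : ℕ} (hn : n ≠ 0)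
    (ha : a ^ (n + 1) = a) : IsIntegral ℤ a := by
  refine ⟨Polynomial.X ^ (n + 1) - Polynomial.X, Polynomial.monic_X_pow_sub ?_, ?_⟩
  · rw [Polynomial.degree_X]
    exact_mod_cast Nat.succ_lt_succ (Nat.pos_of_ne_zero hn)
  · simp [ha]

theorem isIntegral_of_mem_spectrum {R K A : Type*} [CommRing R] [Field K] [Ring A] [Algebra R K]
    [Algebra K A] [Algebra R A] [IsScalarTower R K A] {a : A} {x : K} (ha : IsIntegral R a)
    (hx : x ∈ spectrum K a) : IsIntegral R x := by
  obtain ⟨p, hp, hpa⟩ := ha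
  refine ⟨p, hp, ?_⟩
  by_contra eval_ne_zero
  have eval_mem : (p.map (algebraMap R K)).eval x ∈
      spectrum K (Polynomial.aeval a (p.map (algebraMap R K))) :=
    spectrum.subset_polynomial_aeval a _ ⟨x, hx, rfl⟩
  rw [Polynomial.aeval_map_algebraMap, Polynomial.aeval_def, hpa, Polynomial.eval_map] at eval_mem
  refine eval_mem ?_
  rw [spectrum.mem_resolventSet_iff, sub_zero]
  exact (IsUnit.mk0 _ eval_ne_zero).map (algebraMap K A)

theorem isIntegral_trace_of_isIntegral {R ι K : Type*} [CommRing R] [Fintype ι] [DecidableEq ι]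
    [Field K] [IsAlgClosed K] [Algebra R K] {A : Matrix ι ι K} (hA : IsIntegral R A) :
    IsIntegral R A.trace := by
  rw [Matrix.trace_eq_sum_roots_charpoly]
  refine IsIntegral.multiset_sum fun x hx => isIntegral_of_mem_spectrum hA ?_
  exact Matrix.mem_spectrum_iff_isRoot_charpoly.2 (Polynomial.isRoot_of_mem_roots hx)

section TensorPower

variable {ι κ R : Type*} [Fintype κ] [CommRing R] {n : ℕ}

/-- The Kronecker product of a finite family of matrices: the matrix of the tensor product of a
family of endomorphisms, with rows and columns indexed by tuples. -/
def piKronecker (A : κ → Matrix ι ι R) : Matrix (κ → ι) (κ → ι) R :=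
  .of fun i j => ∏ k, A k (i k) (j k)

theorem piKronecker_apply (A : κ → Matrix ι ι R) (i j : κ → ι) :
    piKronecker A i j = ∏ k, A k (i k) (j k) := rfl

theorem piKronecker_mul [Fintype ι] [DecidableEq κ] (A B : κ → Matrix ι ι R) :
    piKronecker A * piKronecker B = piKronecker (A * B) := by
  ext i j
  simp only [Matrix.mul_apply, Pi.mul_apply, piKronecker_apply, prod_univ_sum, ← prod_mul_distrib,
    Fintype.piFinset_univ]

theorem piKronecker_eq_zero {A : κ → Matrix ι ι R} {k : κ} (h : A k = 0) : piKronecker A = 0 := by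
  ext i j
  exact prod_eq_zero (mem_univ k) (by rw [h, Matrix.zero_apply])

/-- The cyclic rotation `(i₀, …, iₙ₋₁) ↦ (i₁, …, iₙ₋₁, i₀)` of tuples. -/
def rotateTuple (n : ℕ) (ι : Type*) : Equiv.Perm (Fin n → ι) :=
  (finRotate n).symm.arrowCongr (Equiv.refl ι)

theorem rotateTuple_cons (s : ι) (i : Fin n → ι) :
    rotateTuple (n + 1) ι (Fin.cons s i) = Fin.snoc (α := fun _ => ι) i s :=
  (Fin.snoc_eq_cons_rotate i s).symm

theorem prod_ofFn_rotateTuple_eq_one_iff {G : Type*} [Group G] (h : Fin n → G) :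
    (List.ofFn (rotateTuple n G h)).prod = 1 ↔ (List.ofFn h).prod = 1 := by
  cases n with
  | zero => simp
  | succ n =>
    induction h using Fin.consCases with
    | _ s h =>
    rw [rotateTuple_cons, List.ofFn_succ' (Fin.snoc _ _), List.concat_eq_append, List.prod_append,
      List.prod_singleton, List.ofFn_cons, List.prod_cons, mul_eq_one_comm]
    simp only [Fin.snoc_castSucc, Fin.snoc_last]

theorem list_prod_ofFn_matrix_apply [Fintype ι] [DecidableEq ι] (A : Fin (n + 1) → Matrix ι ι R)
    (s t : ι) :
    (List.ofFn A).prod s t = ∑ i : Fin n → ι,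
      ∏ k, A k (Fin.cons (α := fun _ => ι) s i k) (Fin.snoc (α := fun _ => ι) i t k) := by
  induction n generalizing s with
  | zero => simp [Fin.snoc]
  | succ n ih =>
    rw [List.ofFn_succ, List.prod_cons, Matrix.mul_apply, ← (Fin.consEquiv fun _ => ι).sum_comp,
      Fintype.sum_prod_type]
    refine sum_congr rfl fun r _ => ?_
    rw [ih, mul_sum]
    refine sum_congr rfl fun i _ => ?_
    simp only [Fin.consEquiv, Equiv.coe_fn_mk]
    rw [← Fin.cons_snoc_eq_snoc_cons, Fin.prod_univ_succ (n := n + 1)]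
    simp only [Fin.cons_zero, Fin.cons_succ]

section PermMatrix

variable [DecidableEq κ] {M : Matrix κ κ R} {σ : Equiv.Perm κ}

theorem mul_permMatrixHom_apply (i j : κ) :
    (M * Matrix.permMatrixHom σ : Matrix κ κ R) i j = M i (σ j) := by
  change (M * (σ⁻¹).permMatrix R) i j = _
  rw [PEquiv.mul_toMatrix_toPEquiv]
  rfl

theorem permMatrixHom_mul_apply (i j : κ) :
    (Matrix.permMatrixHom σ * M : Matrix κ κ R) (σ i) j = M i j := by
  change ((σ⁻¹).permMatrix R * M) (σ i) j = _
  rw [PEquiv.toMatrix_toPEquiv_mul]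
  simp

theorem commute_permMatrixHom (h : ∀ i j, M (σ i) (σ j) = M i j) :
    Commute M (Matrix.permMatrixHom σ) := by
  ext i j
  obtain ⟨i, rfl⟩ := σ.surjective i
  rw [mul_permMatrixHom_apply, permMatrixHom_mul_apply, h]

end PermMatrix

theorem trace_piKronecker_mul_rotateTuple [Fintype ι] [DecidableEq ι]
    (A : Fin (n + 1) → Matrix ι ι R) :
    (piKronecker A * Matrix.permMatrixHom (rotateTuple (n + 1) ι)).trace =
      (List.ofFn A).prod.trace := by
  rw [Matrix.trace, Matrix.trace, ← (Fin.consEquiv fun _ => ι).sum_comp, Fintype.sum_prod_type]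
  refine sum_congr rfl fun s _ => ?_
  rw [Matrix.diag_apply, list_prod_ofFn_matrix_apply]
  refine sum_congr rfl fun i _ => ?_
  rw [Matrix.diag_apply, mul_permMatrixHom_apply, piKronecker_apply]
  simp only [Fin.consEquiv, Equiv.coe_fn_mk, rotateTuple_cons]

end TensorPower

theorem prod_ofFn_conj_eq_one_iff {G : Type*} [Group G] {n : ℕ} (h : Fin n → G) (x : G) :
    (List.ofFn fun k => x * h k * x⁻¹).prod = 1 ↔ (List.ofFn h).prod = 1 := by
  have conj : (List.ofFn fun k => x * h k * x⁻¹).prod = x * (List.ofFn h).prod * x⁻¹ := by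
    simpa [List.map_ofFn, Function.comp_def] using
      (map_list_prod (MulAut.conj x) (List.ofFn h)).symm
  rw [conj, conj_eq_one_iff]

namespace DrinfeldDouble

variable {G : Type*} [Group G] [Fintype G] [DecidableEq G] {ι : Type*} [Fintype ι] [DecidableEq ι]
  (ρ : DrinfeldDouble G →ₐ[ℂ] Matrix ι ι ℂ) (n : ℕ)

theorem sweedlerPow_e_eq_sum_prod (g x : G) :
    sweedlerPow (DrinfeldDouble G) n (e g x) =
      ∑ h : Fin n → G with (List.ofFn h).prod = g, (List.ofFn fun k => e (h k) x).prod := by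
  simp only [sum_filter]
  induction n generalizing g with
  | zero =>
    rw [sweedlerPow_zero_e]
    simp [eq_comm]
  | succ n ih =>
    rw [← (Fin.snocEquiv fun _ => G).sum_comp, Fintype.sum_prod_type_right]
    simp only [sweedlerPow_succ_e, ih, sum_mul, ite_mul, zero_mul]
    rw [sum_comm]
    refine sum_congr rfl fun h _ => ?_
    rw [sum_ite_eq, if_pos (mem_univ _)]
    simp only [Fin.snocEquiv, Equiv.coe_fn_mk, List.ofFn_succ', List.concat_eq_append,
      List.prod_append, List.prod_singleton, Fin.snoc_castSucc, Fin.snoc_last]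
    simp only [← eq_inv_mul_iff_mul_eq]
    rw [sum_ite_eq', if_pos (mem_univ _)]

/-- The matrix of `e_{h₁} x ⊗ ⋯ ⊗ e_{hₙ} x` on the `n`-th tensor power of the representation `ρ`. -/
noncomputable def tensorE (h : Fin n → G) (x : G) : Matrix (Fin n → ι) (Fin n → ι) ℂ :=
  piKronecker fun k => ρ (e (h k) x)

theorem tensorE_mul_tensorE (h h' : Fin n → G) (x y : G) :
    tensorE ρ n h x * tensorE ρ n h' y =
      if h' = fun k => x⁻¹ * h k * x then tensorE ρ n h (x * y) else 0 := by
  rw [tensorE, tensorE, piKronecker_mul]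
  have conj_iff (k : Fin n) : h k = x * h' k * x⁻¹ ↔ h' k = x⁻¹ * h k * x := by
    rw [eq_mul_inv_iff_mul_eq, mul_assoc x⁻¹, eq_inv_mul_iff_mul_eq, eq_comm]
  split_ifs with hh
  · rw [tensorE]
    congr 1
    funext k
    rw [Pi.mul_apply, ← map_mul, e_mul_e, if_pos ((conj_iff k).2 (congrFun hh k))]
  · obtain ⟨k, hk⟩ := Function.ne_iff.1 hh
    refine piKronecker_eq_zero (k := k) ?_
    rw [Pi.mul_apply, ← map_mul, e_mul_e, if_neg (mt (conj_iff k).1 hk), map_zero]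

theorem tensorE_rotateTuple (h : Fin n → G) (x : G) (i j : Fin n → ι) :
    tensorE ρ n (rotateTuple n G h) x (rotateTuple n ι i) (rotateTuple n ι j) =
      tensorE ρ n h x i j :=
  Equiv.prod_comp (finRotate n) fun k => ρ (e (h k) x) (i k) (j k)

/-- The matrix of the `n`-fold coproduct of `e_1 x`, the sum of all `e_{h₁} x ⊗ ⋯ ⊗ e_{hₙ} x` with
`h₁ ⋯ hₙ = 1`, on the `n`-th tensor power of the representation `ρ`. -/
noncomputable def tensorAction (x : G) : Matrix (Fin n → ι) (Fin n → ι) ℂ :=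
  ∑ h : Fin n → G with (List.ofFn h).prod = 1, tensorE ρ n h x

theorem tensorAction_mul (x y : G) :
    tensorAction ρ n x * tensorAction ρ n y = tensorAction ρ n (x * y) := by
  simp only [tensorAction, sum_mul_sum, tensorE_mul_tensorE, sum_ite_eq']
  refine sum_congr rfl fun h hh => if_pos ?_
  rw [mem_filter_univ] at hh ⊢
  simpa only [inv_inv] using (prod_ofFn_conj_eq_one_iff h x⁻¹).2 hh

theorem commute_tensorAction (x : G) :
    Commute (tensorAction ρ n x) (Matrix.permMatrixHom (rotateTuple n ι)) := by
  refine commute_permMatrixHom fun i j => ?_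
  simp only [tensorAction, Matrix.sum_apply, sum_filter]
  rw [← Equiv.sum_comp (rotateTuple n G)]
  simp only [prod_ofFn_rotateTuple_eq_one_iff, tensorE_rotateTuple]

/-- The matrix of the integral of `D(G)` on the `n`-th tensor power of the representation `ρ`: the
projection onto the invariants. -/
noncomputable def tensorProj : Matrix (Fin n → ι) (Fin n → ι) ℂ :=
  (Fintype.card G : ℂ)⁻¹ • ∑ x, tensorAction ρ n x

theorem isIdempotentElem_tensorProj : IsIdempotentElem (tensorProj ρ n) := by
  refine isIdempotentElem_average fun x _ => ?_
  simp only [mul_sum, tensorAction_mul]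
  exact Equiv.sum_comp (Equiv.mulLeft x) fun y => tensorAction ρ n y

theorem commute_tensorProj :
    Commute (tensorProj ρ n) (Matrix.permMatrixHom (rotateTuple n ι)) :=
  (Commute.sum_left _ _ _ fun x _ => commute_tensorAction ρ n x).smul_left _

theorem trace_sweedlerPow_integral :
    (ρ (sweedlerPow (DrinfeldDouble G) (n + 1) (integral G))).trace =
      (tensorProj ρ (n + 1) * Matrix.permMatrixHom (rotateTuple (n + 1) ι)).trace := by
  simp only [integral, tensorProj, tensorAction, tensorE, map_smul, map_sum,
    sweedlerPow_e_eq_sum_prod, smul_mul_assoc, sum_mul, Matrix.trace_smul, Matrix.trace_sum,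
    trace_piKronecker_mul_rotateTuple, map_list_prod, List.map_ofFn, Function.comp_def]

theorem isIntegral_trace_sweedlerPow_integral :
    IsIntegral ℤ (ρ (sweedlerPow (DrinfeldDouble G) (n + 1) (integral G))).trace := by
  set σ := rotateTuple (n + 1) ι
  have permMatrix_pow : Matrix.permMatrixHom (R := ℂ) σ ^ orderOf σ = 1 := by
    rw [← map_pow, pow_orderOf_eq_one, map_one]
  rw [trace_sweedlerPow_integral]
  refine isIntegral_trace_of_isIntegral (isIntegral_of_pow_succ_eq (orderOf_pos σ).ne' ?_)
  rw [(commute_tensorProj ρ (n + 1)).mul_pow, (isIdempotentElem_tensorProj ρ (n + 1)).pow_succ_eq,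
    pow_succ, permMatrix_pow, one_mul]

theorem isIntegral_indicator {n : ℕ} (hn : n ≠ 0) (V : Type*) [AddCommGroup V] [Module ℂ V]
    [Module (DrinfeldDouble G) V] [IsScalarTower ℂ (DrinfeldDouble G) V] [FiniteDimensional ℂ V] :
    IsIntegral ℤ (indicator (G := G) n V) := by
  obtain ⟨n, rfl⟩ := Nat.exists_eq_succ_of_ne_zero hn
  let b := Module.finBasis ℂ V
  rw [indicator, moduleCharacter, LinearMap.trace_eq_matrix_trace ℂ b]
  exact isIntegral_trace_sweedlerPow_integral
    ((LinearMap.toMatrixAlgEquiv b).toAlgHom.comp (Algebra.lsmul ℂ ℂ V)) n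

theorem isFSZn_of_card_commonRoots_pow_eq {G : Type u} [Group G] [Fintype G] [DecidableEq G]
    {n : ℕ} (hn : n ≠ 0) (hG : ∀ (u z : G) (m : ℕ), (Fintype.card G).Coprime m →
      #(commonRoots n u (z ^ m)) = #(commonRoots n u z)) : IsFSZn.{u, v} n G := by
  intro V _ _ _ _ _
  have := finiteDimensional_of_isSimpleModule (G := G) V
  obtain ⟨q, hq⟩ := exists_rat_indicator_eq V n hG
  have integral_q : IsIntegral ℤ (q : ℂ) := hq ▸ isIntegral_indicator hn V
  obtain ⟨k, rfl⟩ := IsIntegrallyClosed.isIntegral_iff.1 <|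
    (isIntegral_algHom_iff (algebraMap ℚ ℂ).toIntAlgHom (algebraMap ℚ ℂ).injective).1 integral_q
  exact ⟨k, by simp [hq]⟩

end DrinfeldDouble

end Indicators

theorem mainTheorem7_general {X : Type u} [Fintype X] [DecidableEq X] :
    IsFSZ.{u, v} (Equiv.Perm X) := fun _ hn =>
  DrinfeldDouble.isFSZn_of_card_commonRoots_pow_eq hn.ne' fun u _ _ hm =>
    card_commonRoots_pow_of_coprime hn.ne' u (hm.coprime_dvd_left orderOf_dvd_card).symm

theorem mainTheorem7 (N : ℕ) : IsFSZ.{0, v} (Equiv.Perm (Fin N)) :=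
  mainTheorem7_general
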